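/- Throughout, a semigroup is nonempty. An algebra $\mathbf A$ is a set $A$ with a family of basic finitary operations; semigroups are algebras with the single operation $\cdot$, and groups are algebras with the operations $\cdot,{}^{-1},1$. Polynomials of $\mathbf A$ are the operations built from variables and constants from $A$ by the basic operations. For congruences $\alpha,\beta,\delta$ of $\mathbf A$ write $C(\alpha,\beta;\delta)$ if for every $n,m\ge 1$, every $(n+m)$-ary polynomial $p$ and all $\mathbf a,\mathbf b\in A^n$, $\mathbf c,\mathbf d\in A^m$ with $a_i\,\alpha\,b_i$ for all $i$ and $c_j\,\beta\,d_j$ for all $j$, the relation $p(\mathbf a,\mathbf c)\,\delta\,p(\mathbf a,\mathbf d)$ implies $p(\mathbf b,\mathbf c)\,\delta\,p(\mathbf b,\mathbf d)$. The commutator $[\alpha,\beta]$ is the smallest congruence $\delta$ with $C(\alpha,\beta;\delta)$. Let $1_A$ be the full congruence and $0_A$ the equality relation of $\mathbf A$. Put $(1_A,1_A]^{(1)}=[1_A,1_A]$, $(1_A,1_A]^{(k+1)}=[1_A,(1_A,1_A]^{(k)}]$, and $[1_A]^{(1)}=[1_A,1_A]$, $[1_A]^{(k+1)}=[[1_A]^{(k)},[1_A]^{(k)}]$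 for $k\ge 1$. For $n\ge 1$, $\mathbf A$ is $n$-nilpotent if $(1_A,1_A]^{(n)}=0_A$, and $n$-solvable if $[1_A]^{(n)}=0_A$. A semigroup $S$ is orthodox if it is regular (for every $x\in S$ there is $y\in S$ with $xyx=x$) and the product of any two idempotents of $S$ is idempotent. A rectangular band is a semigroup isomorphic to $L\times R$, where $L,R$ are nonempty sets, with multiplication $(l_1,r_1)(l_2,r_2)=(l_1,r_2)$. **Proposition.** Let $n\ge 1$ be an integer and let $S$ be an orthodox semigroup. (i) $S$ is $n$-nilpotent if and only if $S$ is isomorphic to a direct product of an $n$-nilpotent group and a rectangular band. (ii) $S$ is $n$-solvable if and only if $S$ is isomorphic to a direct product of an $n$-solvable group and a rectangular band. -/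

import Mathlib

universe u v w

/-- A congruence of the algebra `A` of signature `L`: an equivalence relation that is compatible
with all basic operations. (Signatures are Mathlib's first-order languages; only their function
symbols play a role here.) -/
structure AlgCon (L : FirstOrder.Language.{v, w}) (A : Type u) [L.Structure A]
    extends Setoid A where
  compat : ∀ {n : ℕ} (f : L.Functions n) (x y : Fin n → A), (∀ i, toSetoid (x i) (y i)) →
    toSetoid (FirstOrder.Language.Structure.funMap f x) (FirstOrder.Language.Structure.funMap f y)

namespace AlgCon

section General

variable {L : FirstOrder.Language.{v, w}} {A : Type u} [L.Structure A]

/-- `θ.Rel x y` says that `x` and `y` are congruent modulo `θ`. -/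
def Rel (θ : AlgCon L A) (x y : A) : Prop := θ.toSetoid x y

theorem ext_rel {θ η : AlgCon L A} (h : ∀ x y, θ.Rel x y ↔ η.Rel x y) : θ = η := by
  cases θ
  cases η
  congr 1
  exact Setoid.ext h

/-- Congruences are ordered by inclusion. -/
instance : PartialOrder (AlgCon L A) where
  le θ η := ∀ x y, θ.Rel x y → η.Rel x y
  le_refl _ _ _ h := h
  le_trans _ _ _ h₁ h₂ x y h := h₂ x y (h₁ x y h)
  le_antisymm _ _ h₁ h₂ := ext_rel fun x y => ⟨h₁ x y, h₂ x y⟩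

/-- The full congruence `1_A`. -/
instance : Top (AlgCon L A) where
  top :=
    { r := fun _ _ => True
      iseqv := ⟨fun _ => trivial, fun _ => trivial, fun _ _ => trivial⟩
      compat := fun _ _ _ _ => trivial }

/-- The equality relation `0_A`. -/
instance : Bot (AlgCon L A) where
  bot :=
    { r := fun x y => x = y
      iseqv := ⟨fun _ => rfl, fun h => h.symm, fun h₁ h₂ => h₁.trans h₂⟩
      compat := fun f x y h => congrArg (FirstOrder.Language.Structure.funMap f) (funext h) }

/-- The intersection of a set of congruences. -/
instance : InfSet (AlgCon L A) where
  sInf T :=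
    { r := fun x y => ∀ θ ∈ T, θ.Rel x y
      iseqv := ⟨fun x θ _ => θ.iseqv.refl x, fun h θ hθ => θ.iseqv.symm (h θ hθ),
        fun h₁ h₂ θ hθ => θ.iseqv.trans (h₁ θ hθ) (h₂ θ hθ)⟩
      compat := fun f x y h θ hθ => θ.compat f x y fun i => h i θ hθ }

/-- The value at `(a, c)` of an `(n + m)`-ary polynomial operation of `A`. A polynomial is a term
whose leaves are constants from `A` (left summand) or one of the `n + m` variables. -/
def polyEval {n m : ℕ} (p : L.Term (A ⊕ (Fin n ⊕ Fin m))) (a : Fin n → A) (c : Fin m → A) : A :=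
  p.realize (Sum.elim id (Sum.elim a c))

/-- `C(α, β; δ)`: `α` centralizes `β` modulo `δ` (the term condition). The condition is trivial
for `n = 0` and for `m = 0`. -/
def Centralizes (α β δ : AlgCon L A) : Prop :=
  ∀ (n m : ℕ) (p : L.Term (A ⊕ (Fin n ⊕ Fin m))) (a b : Fin n → A) (c d : Fin m → A),
    (∀ i, α.Rel (a i) (b i)) → (∀ j, β.Rel (c j) (d j)) →
    δ.Rel (polyEval p a c) (polyEval p a d) → δ.Rel (polyEval p b c) (polyEval p b d)

/-- The binary term condition commutator `[α, β]`. -/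
def commutator (α β : AlgCon L A) : AlgCon L A := sInf {δ | Centralizes α β δ}

/-- `[α, β]` is the smallest congruence `δ` with `C(α, β; δ)`. -/
theorem commutator_isLeast (α β : AlgCon L A) :
    IsLeast {δ | Centralizes α β δ} (commutator α β) :=
  ⟨fun n m p a b c d hab hcd h δ hδ => hδ n m p a b c d hab hcd (h δ hδ),
    fun δ hδ _ _ h => h δ hδ⟩

/-- The series `(ρ, σ]^(k)`: the value at `k + 1` is `[ρ, (ρ, σ]^(k)]`, the value at `1` is
`[ρ, σ]` (the series is started at index `0` with `σ`). -/
def nilSeries (ρ σ : AlgCon L A) : ℕ → AlgCon L A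
  | 0 => σ
  | k + 1 => commutator ρ (nilSeries ρ σ k)

/-- The series `[ρ]^(k)`: the value at `k + 1` is `[[ρ]^(k), [ρ]^(k)]`, the value at `1` is
`[ρ, ρ]` (the series is started at index `0` with `ρ`). -/
def solvSeries (ρ : AlgCon L A) : ℕ → AlgCon L A
  | 0 => ρ
  | k + 1 => commutator (solvSeries ρ k) (solvSeries ρ k)

end General

end AlgCon

/-- The algebra `A` of signature `L` is (left) `n`-nilpotent, `n ≥ 1`: `(1_A, 1_A]^(n) = 0_A`. -/
def IsNilpotentAlg (L : FirstOrder.Language.{v, w}) (A : Type u) [L.Structure A] (n : ℕ) : Prop :=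
  AlgCon.nilSeries (⊤ : AlgCon L A) ⊤ n = ⊥

/-- The algebra `A` of signature `L` is `n`-solvable, `n ≥ 1`: `[1_A]^(n) = 0_A`. -/
def IsSolvableAlg (L : FirstOrder.Language.{v, w}) (A : Type u) [L.Structure A] (n : ℕ) : Prop :=
  AlgCon.solvSeries (⊤ : AlgCon L A) n = ⊥

/-- The operation symbol of semigroups. -/
inductive SemigroupOp : ℕ → Type
  | mul : SemigroupOp 2

/-- The signature of semigroups. -/
def semigroupLang : FirstOrder.Language := ⟨SemigroupOp, fun _ => Empty⟩

/-- A semigroup as an algebra with its multiplication as the only basic operation. -/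
instance semigroupStructure (S : Type u) [Semigroup S] : semigroupLang.Structure S where
  funMap := fun f => match f with
    | SemigroupOp.mul => fun x => x 0 * x 1
  RelMap := fun r => nomatch r

/-- The operation symbols of groups. -/
inductive GroupOp : ℕ → Type
  | one : GroupOp 0
  | inv : GroupOp 1
  | mul : GroupOp 2

/-- The signature of groups. -/
def groupLang : FirstOrder.Language := ⟨GroupOp, fun _ => Empty⟩

/-- A group as an algebra with basic operations identity, inverse and multiplication. -/
instance groupStructure (G : Type u) [Group G] : groupLang.Structure G where
  funMap := fun f => match f with
    | GroupOp.one => fun _ => 1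
    | GroupOp.inv => fun x => (x 0)⁻¹
    | GroupOp.mul => fun x => x 0 * x 1
  RelMap := fun r => nomatch r

/-- A semigroup is orthodox if it is regular and its idempotents form a subsemigroup. -/
structure IsOrthodox (S : Type u) [Semigroup S] : Prop where
  regular : ∀ x : S, ∃ y : S, x * y * x = x
  idempotent_mul : ∀ e f : S, IsIdempotentElem e → IsIdempotentElem f → IsIdempotentElem (e * f)

/-- A rectangular band: a semigroup isomorphic to `L × R`, for nonempty sets `L` and `R`, with the
multiplication `(l₁, r₁) * (l₂, r₂) = (l₁, r₂)`. -/
def IsRectangularBand (B : Type u) [Semigroup B] : Prop :=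
  ∃ (L R : Type u) (_ : Nonempty L) (_ : Nonempty R) (e : B ≃ L × R),
    ∀ x y : B, e (x * y) = ((e x).1, (e y).2)

/-! Forward: if `e ≤ f` are idempotents, the term condition for `x * y` turns `e * e = e * f` into
`e ≡ f` modulo any commutator of congruences containing `(e, f)`. The pair thus survives along both
series, and when they end in equality, `e = f`. In an orthodox semigroup `e * f * e` is an
idempotent below `e`, so `e * f * e = e`. Idempotents can then be deleted inside products, which
gives `S ≃* G × B` with `G = eSe` (`IsOrthodox.exists_mulEquiv_prod`). `G` embeds in `S`, and the
property passes from its semigroup to its group signature because inverses can be supplied as extra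
variables.

Backward: a group congruence lifts to `S` with equality on the band coordinates. There a polynomial
depends on a single letter, so the term condition is automatic (`Centralizes.ofGroupPart`). -/

open FirstOrder FirstOrder.Language

/-! ### Commutators and homomorphisms -/

namespace AlgCon

section General

variable {L : FirstOrder.Language.{v, w}} {A B : Type*} [L.Structure A] [L.Structure B]

theorem commutator_le {α β δ : AlgCon L A} (h : Centralizes α β δ) : commutator α β ≤ δ :=
  (commutator_isLeast α β).2 h

theorem centralizes_commutator (α β : AlgCon L A) : Centralizes α β (commutator α β) :=
  (commutator_isLeast α β).1

/-- The preimage of a congruence under a homomorphism. -/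
def comap (f : A →[L] B) (θ : AlgCon L B) : AlgCon L A where
  r x y := θ.Rel (f x) (f y)
  iseqv := ⟨fun x => θ.iseqv.refl (f x), fun h => θ.iseqv.symm h,
    fun h₁ h₂ => θ.iseqv.trans h₁ h₂⟩
  compat g x y h := by
    rw [f.map_fun, f.map_fun]
    exact θ.compat g _ _ h

theorem polyEval_relabel_hom (f : A →[L] B) {n m : ℕ} (p : L.Term (A ⊕ (Fin n ⊕ Fin m)))
    (a : Fin n → A) (c : Fin m → A) :
    polyEval (p.relabel (Sum.map f id)) (f ∘ a) (f ∘ c) = f (polyEval p a c) := by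
  unfold polyEval
  rw [Term.realize_relabel, ← HomClass.realize_term f]
  congr 1
  funext i
  rcases i with x | i | j <;> rfl

/-- Pushing the constants of a polynomial along `f` reduces the condition to `B`; `f` need not be
surjective, so embeddings are covered. -/
theorem Centralizes.comap (f : A →[L] B) {α β δ : AlgCon L B} (h : Centralizes α β δ)
    {α' β' : AlgCon L A} (hα : α' ≤ AlgCon.comap f α) (hβ : β' ≤ AlgCon.comap f β) :
    Centralizes α' β' (AlgCon.comap f δ) := by
  intro n m p a b c d hab hcd hp
  have := h n m (p.relabel (Sum.map f id)) (f ∘ a) (f ∘ b) (f ∘ c) (f ∘ d)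
    (fun i => hα _ _ (hab i)) (fun j => hβ _ _ (hcd j))
  simp only [polyEval_relabel_hom] at this
  exact this hp

theorem nilSeries_le_comap (f : A →[L] B) (k : ℕ) :
    nilSeries (⊤ : AlgCon L A) ⊤ k ≤ comap f (nilSeries ⊤ ⊤ k) := by
  induction k with
  | zero => exact fun _ _ _ => trivial
  | succ k ih =>
    exact commutator_le ((centralizes_commutator _ _).comap f (fun _ _ _ => trivial) ih)

theorem solvSeries_le_comap (f : A →[L] B) (k : ℕ) :
    solvSeries (⊤ : AlgCon L A) k ≤ comap f (solvSeries ⊤ k) := by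
  induction k with
  | zero => exact fun _ _ _ => trivial
  | succ k ih => exact commutator_le ((centralizes_commutator _ _).comap f ih ih)

theorem eq_bot_of_rel {θ : AlgCon L A} (h : ∀ x y, θ.Rel x y → x = y) : θ = ⊥ :=
  ext_rel fun x y => ⟨h x y, fun e => by cases (show x = y from e); exact θ.iseqv.refl x⟩

theorem eq_of_rel_of_eq_bot {θ : AlgCon L A} (h : θ = ⊥) {x y : A} (hxy : θ.Rel x y) : x = y := by
  subst h
  exact hxy

end General

end AlgCon

section Injective

variable {L : FirstOrder.Language.{v, w}} {A B : Type*} [L.Structure A] [L.Structure B] {n : ℕ}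

theorem IsNilpotentAlg.of_injective (h : IsNilpotentAlg L B n) (f : A →[L] B)
    (hf : Function.Injective f) : IsNilpotentAlg L A n :=
  AlgCon.eq_bot_of_rel fun x y hxy =>
    hf (AlgCon.eq_of_rel_of_eq_bot h (AlgCon.nilSeries_le_comap f n x y hxy))

theorem IsSolvableAlg.of_injective (h : IsSolvableAlg L B n) (f : A →[L] B)
    (hf : Function.Injective f) : IsSolvableAlg L A n :=
  AlgCon.eq_bot_of_rel fun x y hxy =>
    hf (AlgCon.eq_of_rel_of_eq_bot h (AlgCon.solvSeries_le_comap f n x y hxy))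

end Injective

/-- A multiplicative map as a homomorphism of algebras. -/
def MulHom.toSemigroupLangHom {S T : Type*} [Semigroup S] [Semigroup T] (f : S →ₙ* T) :
    S →[semigroupLang] T where
  toFun := f
  map_fun' g x := by
    cases g
    exact map_mul f (x 0) (x 1)
  map_rel' r := nomatch r

/-- The product of two terms in the language of semigroups. -/
def semigroupLang.mulTerm {α : Type*} (s t : semigroupLang.Term α) : semigroupLang.Term α :=
  Term.func (L := semigroupLang) (l := 2) SemigroupOp.mul ![s, t]

theorem AlgCon.rel_mul {S : Type*} [Semigroup S] (θ : AlgCon semigroupLang S) {x y x' y' : S}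
    (h : θ.Rel x y) (h' : θ.Rel x' y') : θ.Rel (x * x') (y * y') :=
  θ.compat (n := 2) SemigroupOp.mul ![x, x'] ![y, y'] (by
    intro i
    fin_cases i
    · exact h
    · exact h')

/-! ### From the semigroup to the group signature -/

section Group

variable {G : Type*} [Group G]

namespace AlgCon

theorem rel_mul_group (θ : AlgCon groupLang G) {x y x' y' : G}
    (h : θ.Rel x y) (h' : θ.Rel x' y') : θ.Rel (x * x') (y * y') :=
  θ.compat (n := 2) GroupOp.mul ![x, x'] ![y, y'] (by
    intro i
    fin_cases i
    · exact h
    · exact h')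

theorem rel_inv (θ : AlgCon semigroupLang G) {x y : G} (h : θ.Rel x y) : θ.Rel x⁻¹ y⁻¹ := by
  have := θ.rel_mul (θ.rel_mul (θ.iseqv.refl x⁻¹) h) (θ.iseqv.refl y⁻¹)
  rw [inv_mul_cancel, one_mul, mul_assoc, mul_inv_cancel, mul_one] at this
  exact θ.iseqv.symm this

theorem rel_append_inv (θ : AlgCon semigroupLang G) {n : ℕ} {a b : Fin n → G}
    (h : ∀ i, θ.Rel (a i) (b i)) (i : Fin (n + n)) :
    θ.Rel (Fin.append a a⁻¹ i) (Fin.append b b⁻¹ i) := by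
  refine Fin.addCases (fun i => ?_) (fun i => ?_) i
  · rw [Fin.append_left, Fin.append_left]
    exact h i
  · rw [Fin.append_right, Fin.append_right]
    exact θ.rel_inv (h i)

/-- A semigroup congruence of a group is a group congruence. -/
def toGroupLang (θ : AlgCon semigroupLang G) : AlgCon groupLang G where
  toSetoid := θ.toSetoid
  compat f x y h := by
    cases f with
    | one => exact θ.iseqv.refl _
    | inv => exact θ.rel_inv (h 0)
    | mul => exact θ.rel_mul (h 0) (h 1)

/-- Group terms become semigroup terms if the inverses of the variables are added as variables. -/
theorem exists_semigroupLang_term {n m : ℕ} (t : groupLang.Term (G ⊕ (Fin n ⊕ Fin m))) :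
    ∃ s s' : semigroupLang.Term (G ⊕ (Fin (n + n) ⊕ Fin (m + m))),
      ∀ (a : Fin n → G) (c : Fin m → G),
        polyEval s (Fin.append a a⁻¹) (Fin.append c c⁻¹) = polyEval t a c ∧
        polyEval s' (Fin.append a a⁻¹) (Fin.append c c⁻¹) = (polyEval t a c)⁻¹ := by
  -- The term `s'` for the inverse strengthens the induction: `inv` swaps the two terms, and `mul`
  -- uses `(xy)⁻¹ = y⁻¹x⁻¹`.
  induction t with
  | var i =>
    rcases i with x | i | j
    · exact ⟨Term.var (Sum.inl x), Term.var (Sum.inl x⁻¹), fun a c => ⟨rfl, rfl⟩⟩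
    · exact ⟨Term.var (Sum.inr (Sum.inl (Fin.castAdd n i))),
        Term.var (Sum.inr (Sum.inl (Fin.natAdd n i))), fun a c =>
          ⟨Fin.append_left a a⁻¹ i, Fin.append_right a a⁻¹ i⟩⟩
    · exact ⟨Term.var (Sum.inr (Sum.inr (Fin.castAdd m j))),
        Term.var (Sum.inr (Sum.inr (Fin.natAdd m j))), fun a c =>
          ⟨Fin.append_left c c⁻¹ j, Fin.append_right c c⁻¹ j⟩⟩
  | func f ts ih =>
    cases f with
    | one =>
      exact ⟨Term.var (Sum.inl 1), Term.var (Sum.inl 1), fun a c => ⟨rfl, inv_one.symm⟩⟩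
    | inv =>
      obtain ⟨s, s', h⟩ := ih 0
      exact ⟨s', s, fun a c => ⟨(h a c).2, (h a c).1.trans (inv_inv _).symm⟩⟩
    | mul =>
      obtain ⟨s, s', h⟩ := ih 0
      obtain ⟨t, t', k⟩ := ih 1
      refine ⟨semigroupLang.mulTerm s t, semigroupLang.mulTerm t' s', fun a c => ⟨?_, ?_⟩⟩
      · exact congrArg₂ (· * ·) (h a c).1 (k a c).1
      · exact (congrArg₂ (· * ·) (k a c).2 (h a c).2).trans (mul_inv_rev _ _).symm

theorem Centralizes.toGroupLang {α β δ : AlgCon semigroupLang G} (h : Centralizes α β δ)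
    {α' β' : AlgCon groupLang G} (hα : α' ≤ α.toGroupLang) (hβ : β' ≤ β.toGroupLang) :
    Centralizes α' β' δ.toGroupLang := by
  intro n m p a b c d hab hcd hp
  obtain ⟨s, _, hs⟩ := exists_semigroupLang_term p
  have key := h (n + n) (m + m) s (Fin.append a a⁻¹) (Fin.append b b⁻¹) (Fin.append c c⁻¹)
    (Fin.append d d⁻¹)
    (α.rel_append_inv fun i => hα _ _ (hab i)) (β.rel_append_inv fun j => hβ _ _ (hcd j))
  rw [(hs a c).1, (hs a d).1, (hs b c).1, (hs b d).1] at key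
  exact key hp

theorem nilSeries_le_toGroupLang (k : ℕ) :
    nilSeries (⊤ : AlgCon groupLang G) ⊤ k ≤ (nilSeries ⊤ ⊤ k).toGroupLang := by
  induction k with
  | zero => exact fun _ _ _ => trivial
  | succ k ih =>
    exact commutator_le ((centralizes_commutator _ _).toGroupLang (fun _ _ _ => trivial) ih)

theorem solvSeries_le_toGroupLang (k : ℕ) :
    solvSeries (⊤ : AlgCon groupLang G) k ≤ (solvSeries ⊤ k).toGroupLang := by
  induction k with
  | zero => exact fun _ _ _ => trivial
  | succ k ih => exact commutator_le ((centralizes_commutator _ _).toGroupLang ih ih)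

end AlgCon

theorem IsNilpotentAlg.toGroupLang {n : ℕ} (h : IsNilpotentAlg semigroupLang G n) :
    IsNilpotentAlg groupLang G n :=
  AlgCon.eq_bot_of_rel fun x y hxy =>
    AlgCon.eq_of_rel_of_eq_bot h (AlgCon.nilSeries_le_toGroupLang n x y hxy)

theorem IsSolvableAlg.toGroupLang {n : ℕ} (h : IsSolvableAlg semigroupLang G n) :
    IsSolvableAlg groupLang G n :=
  AlgCon.eq_bot_of_rel fun x y hxy =>
    AlgCon.eq_of_rel_of_eq_bot h (AlgCon.solvSeries_le_toGroupLang n x y hxy)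

end Group

/-! ### Lifting from a group to a rectangular group -/

section RectangularGroup

variable {S G X Y : Type*} [Semigroup S] [Group G]

/-- Every semigroup term over a semigroup can be read as a group term along a multiplicative map
to a group. -/
theorem exists_groupLang_term (φ : S →ₙ* G) {n m : ℕ}
    (t : semigroupLang.Term (S ⊕ (Fin n ⊕ Fin m))) :
    ∃ s : groupLang.Term (G ⊕ (Fin n ⊕ Fin m)), ∀ (a : Fin n → S) (c : Fin m → S),
      AlgCon.polyEval s (φ ∘ a) (φ ∘ c) = φ (AlgCon.polyEval t a c) := by
  induction t with
  | var i =>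
    refine ⟨Term.var (Sum.map φ id i), fun a c => ?_⟩
    rcases i with x | i | j <;> rfl
  | func f ts ih =>
    cases f
    obtain ⟨s, hs⟩ := ih 0
    obtain ⟨t, ht⟩ := ih 1
    refine ⟨Term.func (L := groupLang) (l := 2) GroupOp.mul ![s, t], fun a c => ?_⟩
    exact (congrArg₂ (· * ·) (hs a c) (ht a c)).trans (map_mul φ _ _).symm

/-- A map invariant under right multiplication depends only on the first letter of a term. -/
theorem exists_realize_eq_of_mul_left {l : S → X} (hl : ∀ x y, l (x * y) = l x) {α : Type*}
    (t : semigroupLang.Term α) : ∃ i, ∀ v : α → S, l (t.realize v) = l (v i) := by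
  induction t with
  | var i => exact ⟨i, fun _ => rfl⟩
  | func f ts ih =>
    cases f
    obtain ⟨i, hi⟩ := ih 0
    exact ⟨i, fun v => (hl _ _).trans (hi v)⟩

/-- A map invariant under left multiplication depends only on the last letter of a term. -/
theorem exists_realize_eq_of_mul_right {r : S → Y} (hr : ∀ x y, r (x * y) = r y) {α : Type*}
    (t : semigroupLang.Term α) : ∃ i, ∀ v : α → S, r (t.realize v) = r (v i) := by
  induction t with
  | var i => exact ⟨i, fun _ => rfl⟩
  | func f ts ih =>
    cases f
    obtain ⟨i, hi⟩ := ih 1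
    exact ⟨i, fun v => (hr _ _).trans (hi v)⟩

/-- If the decisive letter is a constant or lies in the first block, the second block has no
influence; otherwise the first block has none and the conclusion is `h`. -/
theorem polyEval_eq_of_exists_letter {l : S → X} {n m : ℕ}
    {p : semigroupLang.Term (S ⊕ (Fin n ⊕ Fin m))}
    (hp : ∃ i, ∀ v, l (p.realize v) = l (v i)) {a : Fin n → S} (b : Fin n → S) {c d : Fin m → S}
    (h : l (AlgCon.polyEval p a c) = l (AlgCon.polyEval p a d)) :
    l (AlgCon.polyEval p b c) = l (AlgCon.polyEval p b d) := by
  obtain ⟨i, hi⟩ := hp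
  unfold AlgCon.polyEval at *
  rw [hi, hi] at *
  rcases i with x | i | j
  · rfl
  · rfl
  · exact h

variable (φ : S →ₙ* G) {l : S → X} {r : S → Y} (hl : ∀ x y, l (x * y) = l x)
  (hr : ∀ x y, r (x * y) = r y)

namespace AlgCon

/-- The congruence of a rectangular group that is given by a congruence of its group part and by
equality in the rectangular band part. -/
def ofGroupPart (θ : AlgCon groupLang G) : AlgCon semigroupLang S where
  r x y := θ.Rel (φ x) (φ y) ∧ l x = l y ∧ r x = r y
  iseqv := ⟨fun x => ⟨θ.iseqv.refl _, rfl, rfl⟩,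
    fun h => ⟨θ.iseqv.symm h.1, h.2.1.symm, h.2.2.symm⟩,
    fun h₁ h₂ => ⟨θ.iseqv.trans h₁.1 h₂.1, h₁.2.1.trans h₂.2.1, h₁.2.2.trans h₂.2.2⟩⟩
  compat f x y h := by
    cases f
    change θ.Rel (φ (x 0 * x 1)) (φ (y 0 * y 1)) ∧ l (x 0 * x 1) = l (y 0 * y 1) ∧
      r (x 0 * x 1) = r (y 0 * y 1)
    rw [map_mul, map_mul, hl, hl, hr, hr]
    exact ⟨θ.rel_mul_group (h 0).1 (h 1).1, (h 0).2.1, (h 1).2.2⟩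

theorem Centralizes.ofGroupPart {α β δ : AlgCon groupLang G} (h : Centralizes α β δ)
    {α' β' : AlgCon semigroupLang S} (hα : ∀ x y, α'.Rel x y → α.Rel (φ x) (φ y))
    (hβ : ∀ x y, β'.Rel x y → β.Rel (φ x) (φ y)) :
    Centralizes α' β' (δ.ofGroupPart φ hl hr) := by
  rintro n m p a b c d hab hcd ⟨hp₁, hp₂, hp₃⟩
  refine ⟨?_, polyEval_eq_of_exists_letter (exists_realize_eq_of_mul_left hl p) b hp₂,
    polyEval_eq_of_exists_letter (exists_realize_eq_of_mul_right hr p) b hp₃⟩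
  obtain ⟨s, hs⟩ := exists_groupLang_term φ p
  have key := h n m s (φ ∘ a) (φ ∘ b) (φ ∘ c) (φ ∘ d) (fun i => hα _ _ (hab i))
    (fun j => hβ _ _ (hcd j))
  rw [hs, hs, hs, hs] at key
  exact key hp₁

include hl hr in
theorem nilSeries_rel_map (k : ℕ) (x y : S)
    (h : (nilSeries (⊤ : AlgCon semigroupLang S) ⊤ k).Rel x y) :
    (nilSeries (⊤ : AlgCon groupLang G) ⊤ k).Rel (φ x) (φ y) := by
  induction k generalizing x y with
  | zero => trivial
  | succ k ih =>
    exact (commutator_le ((centralizes_commutator _ _).ofGroupPart φ hl hr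
      (α := ⊤) (fun _ _ _ => trivial) ih) x y h).1

include hl hr in
theorem solvSeries_rel_map (k : ℕ) (x y : S)
    (h : (solvSeries (⊤ : AlgCon semigroupLang S) k).Rel x y) :
    (solvSeries (⊤ : AlgCon groupLang G) k).Rel (φ x) (φ y) := by
  induction k generalizing x y with
  | zero => trivial
  | succ k ih =>
    exact (commutator_le ((centralizes_commutator _ _).ofGroupPart φ hl hr ih ih) x y h).1

end AlgCon

variable (hinj : ∀ x y, φ x = φ y → l x = l y → r x = r y → x = y)

include hl hr hinj in
theorem IsNilpotentAlg.of_groupPart {n : ℕ} (hn : 1 ≤ n) (h : IsNilpotentAlg groupLang G n) :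
    IsNilpotentAlg semigroupLang S n := by
  -- The last commutator gives equality in the band; at index `0` the full congruence would not.
  obtain ⟨k, rfl⟩ := Nat.exists_eq_add_of_le' hn
  refine AlgCon.eq_bot_of_rel fun x y hxy => ?_
  obtain ⟨h₁, h₂, h₃⟩ := AlgCon.commutator_le
    ((AlgCon.centralizes_commutator _ _).ofGroupPart φ hl hr (α := ⊤) (fun _ _ _ => trivial)
      (AlgCon.nilSeries_rel_map φ hl hr k)) x y hxy
  exact hinj x y (AlgCon.eq_of_rel_of_eq_bot h h₁) h₂ h₃

include hl hr hinj in
theorem IsSolvableAlg.of_groupPart {n : ℕ} (hn : 1 ≤ n) (h : IsSolvableAlg groupLang G n) :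
    IsSolvableAlg semigroupLang S n := by
  obtain ⟨k, rfl⟩ := Nat.exists_eq_add_of_le' hn
  refine AlgCon.eq_bot_of_rel fun x y hxy => ?_
  obtain ⟨h₁, h₂, h₃⟩ := AlgCon.commutator_le
    ((AlgCon.centralizes_commutator _ _).ofGroupPart φ hl hr
      (AlgCon.solvSeries_rel_map φ hl hr k) (AlgCon.solvSeries_rel_map φ hl hr k)) x y hxy
  exact hinj x y (AlgCon.eq_of_rel_of_eq_bot h h₁) h₂ h₃

end RectangularGroup

/-! ### Comparable idempotents -/

section Idempotents

variable {S : Type*} [Semigroup S] {e f : S}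

theorem AlgCon.commutator_rel_of_idempotent_le {α β : AlgCon semigroupLang S}
    (he : e * e = e) (hf : f * f = f) (hef : e * f = e) (hfe : f * e = e)
    (hα : α.Rel e f) (hβ : β.Rel e f) : (commutator α β).Rel e f := by
  have key := centralizes_commutator α β 1 1
    (semigroupLang.mulTerm (Term.var (Sum.inr (Sum.inl 0))) (Term.var (Sum.inr (Sum.inr 0))))
    (fun _ => e) (fun _ => f) (fun _ => e) (fun _ => f) (fun _ => hα) (fun _ => hβ)
  change (commutator α β).Rel (e * e) (e * f) → (commutator α β).Rel (f * e) (f * f) at key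
  rw [he, hf, hef, hfe] at key
  exact key ((commutator α β).iseqv.refl e)

theorem IsNilpotentAlg.eq_of_idempotent_le {n : ℕ} (h : IsNilpotentAlg semigroupLang S n)
    (he : e * e = e) (hf : f * f = f) (hef : e * f = e) (hfe : f * e = e) : e = f := by
  refine AlgCon.eq_of_rel_of_eq_bot h ?_
  clear h
  induction n with
  | zero => trivial
  | succ k ih => exact AlgCon.commutator_rel_of_idempotent_le he hf hef hfe trivial ih

theorem IsSolvableAlg.eq_of_idempotent_le {n : ℕ} (h : IsSolvableAlg semigroupLang S n)
    (he : e * e = e) (hf : f * f = f) (hef : e * f = e) (hfe : f * e = e) : e = f := by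
  refine AlgCon.eq_of_rel_of_eq_bot h ?_
  clear h
  induction n with
  | zero => trivial
  | succ k ih => exact AlgCon.commutator_rel_of_idempotent_le he hf hef hfe ih ih

end Idempotents

/-- The rectangular band on `X × Y`. -/
def RectBand (X Y : Type*) := X × Y

instance (X Y : Type*) : Semigroup (RectBand X Y) where
  mul x y := (x.1, y.2)
  mul_assoc _ _ _ := rfl

theorem isRectangularBand_rectBand (X Y : Type u) [Nonempty X] [Nonempty Y] :
    IsRectangularBand (RectBand X Y) :=
  ⟨X, Y, ‹_›, ‹_›, Equiv.refl _, fun _ _ => rfl⟩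

/-! ### Orthodox semigroups with only trivially comparable idempotents -/

section Structure

variable {S : Type u} [Semigroup S]

/-- By regularity `x = xf` and `y = gy` with `f`, `g` idempotent, and `feg = fe(gfg) = (f(eg)f)g =
fg`. -/
theorem IsOrthodox.mul_idempotent_mul (hS : IsOrthodox S)
    (hrect : ∀ e f : S, e * e = e → f * f = f → e * f * e = e) {e : S} (he : e * e = e)
    (x y : S) : x * e * y = x * y := by
  obtain ⟨x', hx⟩ := hS.regular x
  obtain ⟨y', hy⟩ := hS.regular y
  have hf : (x' * x) * (x' * x) = x' * x := by
    rw [mul_assoc, ← mul_assoc x x' x, hx]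
  have hg : (y * y') * (y * y') = y * y' := by
    rw [← mul_assoc, hy]
  generalize hfx : x' * x = f at hf
  generalize hgy : y * y' = g at hg
  have hxf : x * f = x := by rw [← hfx, ← mul_assoc, hx]
  have hgy' : g * y = y := by rw [← hgy, hy]
  have h : f * e * g = f * g :=
    calc f * e * g = f * e * (g * f * g) := by rw [hrect g f hg hf]
      _ = f * (e * g) * f * g := by simp only [mul_assoc]
      _ = f * g := by rw [hrect f (e * g) hf (hS.idempotent_mul e g he hg)]
  calc x * e * y = x * f * e * (g * y) := by rw [hxf, hgy']
    _ = x * (f * e * g) * y := by simp only [mul_assoc]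
    _ = x * f * (g * y) := by rw [h]; simp only [mul_assoc]
    _ = x * y := by rw [hxf, hgy']

/-- The local subsemigroup `eSe`. -/
abbrev LocalMonoid (e : S) : Type u := {x : S // e * x = x ∧ x * e = x}

theorem IsOrthodox.exists_inv (hS : IsOrthodox S)
    (hrect : ∀ e f : S, e * e = e → f * f = f → e * f * e = e) {e : S} (he : e * e = e)
    (x : LocalMonoid e) : ∃ y : LocalMonoid e, y.1 * x.1 = e := by
  obtain ⟨x, hx, hx'⟩ := x
  obtain ⟨y, hy⟩ := hS.regular x
  refine ⟨⟨e * y * e, ?_, ?_⟩, ?_⟩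
  · simp only [← mul_assoc, he]
  · simp only [mul_assoc, he]
  · have hf : (y * x) * (y * x) = y * x := by rw [mul_assoc, ← mul_assoc x y x, hy]
    calc e * y * e * x = e * (y * x) * e := by simp only [mul_assoc, hx, hx']
      _ = e := hrect e _ he hf

/-- The local subsemigroup `eSe` of a rectangular group is a group. -/
noncomputable abbrev IsOrthodox.localGroup (hS : IsOrthodox S)
    (hrect : ∀ e f : S, e * e = e → f * f = f → e * f * e = e) {e : S} (he : e * e = e) :
    Group (LocalMonoid e) :=
  letI : Mul (LocalMonoid e) := ⟨fun x y => ⟨x.1 * y.1, by rw [← mul_assoc, x.2.1],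
    by rw [mul_assoc, y.2.2]⟩⟩
  letI : One (LocalMonoid e) := ⟨⟨e, he, he⟩⟩
  letI : Inv (LocalMonoid e) := ⟨fun x => (hS.exists_inv hrect he x).choose⟩
  Group.ofLeftAxioms (fun _ _ _ => Subtype.ext (mul_assoc _ _ _)) (fun x => Subtype.ext x.2.1)
    (fun x => Subtype.ext (hS.exists_inv hrect he x).choose_spec)

theorem IsOrthodox.exists_mulEquiv_prod [Nonempty S] (hS : IsOrthodox S)
    (hle : ∀ e f : S, e * e = e → f * f = f → e * f = e → f * e = e → e = f) :
    ∃ (G : Type u) (_ : Group G) (B : Type u) (_ : Semigroup B),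
      IsRectangularBand B ∧ Nonempty (S ≃* G × B) := by
  -- `e * f * e` is an idempotent below `e`.
  have hrect : ∀ e f : S, e * e = e → f * f = f → e * f * e = e := fun e f he hf =>
    hle _ _ (hS.idempotent_mul _ _ (hS.idempotent_mul e f he hf) he) he
      (by rw [mul_assoc, he]) (by rw [← mul_assoc, ← mul_assoc, he])
  obtain ⟨e, he⟩ : ∃ e : S, e * e = e := by
    obtain ⟨x⟩ := ‹Nonempty S›
    obtain ⟨y, hy⟩ := hS.regular x
    exact ⟨x * y, by rw [← mul_assoc, hy]⟩
  have hmid : ∀ {f : S}, f * f = f → ∀ x y, x * f * y = x * y :=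
    fun hf => hS.mul_idempotent_mul hrect hf
  let _ := hS.localGroup hrect he
  have hinv : ∀ g : LocalMonoid e, (g⁻¹).1 * g.1 = e := fun g =>
    congrArg Subtype.val (inv_mul_cancel g)
  have hinv' : ∀ g : LocalMonoid e, g.1 * (g⁻¹).1 = e := fun g =>
    congrArg Subtype.val (mul_inv_cancel g)
  let X := {f : S // f * f = f ∧ f * e = f}
  let Y := {f : S // f * f = f ∧ e * f = f}
  have : Nonempty X := ⟨⟨e, he, he⟩⟩
  have : Nonempty Y := ⟨⟨e, he, he⟩⟩
  have heX : ∀ f : X, e * f.1 = e := fun f => by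
    rw [← f.2.2, ← mul_assoc, hrect e f.1 he f.2.1]
  have heY : ∀ f : Y, f.1 * e = e := fun f => by
    rw [← f.2.2, hrect e f.1 he f.2.1]
  -- Rees matrix coordinates; the sandwich factor `p.2.2.1 * q.2.1.1` is idempotent, so `hmid`
  -- removes it.
  let F : LocalMonoid e × RectBand X Y → S := fun p => p.2.1.1 * p.1.1 * p.2.2.1
  have hF : ∀ p q, F (p * q) = F p * F q := by
    intro p q
    calc F (p * q) = p.2.1.1 * (p.1.1 * q.1.1) * q.2.2.1 := rfl
      _ = (p.2.1.1 * p.1.1) * (q.1.1 * q.2.2.1) := by simp only [mul_assoc]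
      _ = (p.2.1.1 * p.1.1) * (p.2.2.1 * q.2.1.1) * (q.1.1 * q.2.2.1) :=
        (hmid (hS.idempotent_mul _ _ p.2.2.2.1 q.2.1.2.1) _ _).symm
      _ = F p * F q := by simp only [F, mul_assoc]
  have hFg : ∀ p, e * F p * e = p.1.1 := by
    intro p
    calc e * F p * e = (e * p.2.1.1) * p.1.1 * (p.2.2.1 * e) := by simp only [F, mul_assoc]
      _ = p.1.1 := by rw [heX, heY, p.1.2.1, p.1.2.2]
  have hFl : ∀ p, F p * (p.1⁻¹).1 = p.2.1.1 := by
    intro p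
    calc F p * (p.1⁻¹).1 = p.2.1.1 * p.1.1 * p.2.2.1 * (p.1⁻¹).1 := rfl
      _ = p.2.1.1 * (p.1.1 * (p.1⁻¹).1) := by rw [hmid p.2.2.2.1, mul_assoc]
      _ = p.2.1.1 := by rw [hinv', p.2.1.2.2]
  have hFr : ∀ p, (p.1⁻¹).1 * F p = p.2.2.1 := by
    intro p
    calc (p.1⁻¹).1 * F p = (p.1⁻¹).1 * p.2.1.1 * (p.1.1 * p.2.2.1) := by
          simp only [F, mul_assoc]
      _ = (p.1⁻¹).1 * p.1.1 * p.2.2.1 := by rw [hmid p.2.1.2.1, mul_assoc]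
      _ = p.2.2.1 := by rw [hinv, p.2.2.2.2]
  have hinj : Function.Injective F := by
    intro p q hpq
    have h₁ : p.1 = q.1 := Subtype.ext (by rw [← hFg p, hpq, hFg q])
    have h₂ : p.2.1 = q.2.1 := Subtype.ext (by rw [← hFl p, hpq, h₁, hFl q])
    have h₃ : p.2.2 = q.2.2 := Subtype.ext (by rw [← hFr p, hpq, h₁, hFr q])
    exact Prod.ext h₁ (Prod.ext h₂ h₃)
  have hsurj : Function.Surjective F := by
    intro x
    let g : LocalMonoid e := ⟨e * x * e, by simp only [← mul_assoc, he],
      by simp only [mul_assoc, he]⟩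
    -- With `k` the inverse of `exe` in `eSe`, the preimage of `x` comes from `x = (xk)(exe)(kx)`.
    set k : S := (g⁻¹).1
    have hek : e * k = k := (g⁻¹).2.1
    have hke : k * e = k := (g⁻¹).2.2
    have hkx : k * x * e = e := by
      calc k * x * e = k * e * x * e := by rw [hke]
        _ = k * (e * x * e) := by simp only [mul_assoc]
        _ = e := hinv g
    have hxk : e * x * k = e := by
      calc e * x * k = e * x * (e * k) := by rw [hek]
        _ = e * x * e * k := by simp only [mul_assoc]
        _ = e := hinv' g
    let a : X := ⟨x * k, by
      calc x * k * (x * k) = x * (k * x * e) * k := by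
            rw [← hek]; simp only [mul_assoc]; rw [← mul_assoc e e k, he]
        _ = x * k := by rw [hkx, mul_assoc, hek], by rw [mul_assoc, hke]⟩
    let b : Y := ⟨k * x, by
      calc k * x * (k * x) = k * (e * x * k) * x := by
            rw [← hke]; simp only [mul_assoc]; rw [← mul_assoc e e, he]
        _ = k * x := by rw [hxk, hke], by rw [← mul_assoc, hek]⟩
    refine ⟨(g, (a, b)), ?_⟩
    obtain ⟨x', hx⟩ := hS.regular x
    have hz : x * k * (e * x * e) * (k * x) = x * k * x := by
      calc x * k * (e * x * e) * (k * x) = x * k * ((e * x) * (e * k) * x) := by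
            simp only [mul_assoc]
        _ = x * k * (e * x * k * x) := by rw [hek]
        _ = x * (k * e) * x := by rw [hxk]; simp only [mul_assoc]
        _ = x * k * x := by rw [hke]
    change x * k * (e * x * e) * (k * x) = x
    rw [hz]
    -- Inserting `e` after `x * x'` creates `e * x * k = e`, which absorbs `k`; this `e` is then
    -- deleted.
    calc x * k * x = (x * x' * x) * k * (x * x' * x) := by rw [hx]
      _ = (x * x') * (x * k * x) * (x' * x) := by simp only [mul_assoc]
      _ = (x * x' * e) * (x * k * x) * (x' * x) := by
          rw [← hmid he (x * x') (x * k * x)]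
      _ = (x * x') * (e * x * k) * x * (x' * x) := by simp only [mul_assoc]
      _ = (x * x') * x * (x' * x) := by rw [hxk, hmid he]
      _ = x := by rw [hx, ← mul_assoc, hx]
  exact ⟨LocalMonoid e, inferInstance, RectBand X Y, inferInstance,
    isRectangularBand_rectBand X Y,
    ⟨(MulEquiv.ofBijective (MulHom.mk F hF) ⟨hinj, hsurj⟩).symm⟩⟩

end Structure

/-! ### Assembling the equivalences -/

theorem IsRectangularBand.mul_self {B : Type*} [Semigroup B] (hB : IsRectangularBand B) (b : B) :
    b * b = b := by
  obtain ⟨L, R, _, _, ε, hε⟩ := hB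
  exact ε.injective (hε b b)

/-- The embedding of the first factor in the product with an idempotent of the second. -/
def MulEquiv.leftFactorHom {S G B : Type*} [Semigroup S] [Group G] [Semigroup B]
    (ε : S ≃* G × B) {b : B} (hb : b * b = b) : G →ₙ* S where
  toFun g := ε.symm (g, b)
  map_mul' g h := by rw [← map_mul, Prod.mk_mul_mk, hb]

theorem MulEquiv.leftFactorHom_injective {S G B : Type*} [Semigroup S] [Group G] [Semigroup B]
    (ε : S ≃* G × B) {b : B} (hb : b * b = b) : Function.Injective (ε.leftFactorHom hb) :=
  fun _ _ h => congrArg Prod.fst (ε.symm.injective h)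

theorem mainTheorem2 {S : Type u} [Semigroup S] [Nonempty S] (hS : IsOrthodox S)
    (n : ℕ) (hn : 1 ≤ n) :
    (IsNilpotentAlg semigroupLang S n ↔
      ∃ (G : Type u) (_ : Group G) (B : Type u) (_ : Semigroup B),
        IsNilpotentAlg groupLang G n ∧ IsRectangularBand B ∧ Nonempty (S ≃* G × B)) ∧
    (IsSolvableAlg semigroupLang S n ↔
      ∃ (G : Type u) (_ : Group G) (B : Type u) (_ : Semigroup B),
        IsSolvableAlg groupLang G n ∧ IsRectangularBand B ∧ Nonempty (S ≃* G × B)) := by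
  refine ⟨⟨fun h => ?_, ?_⟩, ⟨fun h => ?_, ?_⟩⟩
  · obtain ⟨G, _, B, _, hB, ⟨ε⟩⟩ :=
      hS.exists_mulEquiv_prod fun _ _ he hf hef hfe => h.eq_of_idempotent_le he hf hef hfe
    obtain ⟨x⟩ := ‹Nonempty S›
    have hb := hB.mul_self (ε x).2
    exact ⟨G, _, B, _, (h.of_injective (ε.leftFactorHom hb).toSemigroupLangHom
      (ε.leftFactorHom_injective hb)).toGroupLang, hB, ⟨ε⟩⟩
  · rintro ⟨G, _, B, _, hG, ⟨L, R, _, _, η, hη⟩, ⟨ε⟩⟩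
    refine IsNilpotentAlg.of_groupPart ((MulHom.fst G B).comp ε.toMulHom)
      (l := fun x => (η (ε x).2).1) (r := fun x => (η (ε x).2).2) (fun x y => ?_) (fun x y => ?_)
      (fun x y h₁ h₂ h₃ => ?_) hn hG
    · rw [map_mul, Prod.snd_mul, hη]
    · rw [map_mul, Prod.snd_mul, hη]
    · exact ε.injective (Prod.ext h₁ (η.injective (Prod.ext h₂ h₃)))
  · obtain ⟨G, _, B, _, hB, ⟨ε⟩⟩ :=
      hS.exists_mulEquiv_prod fun _ _ he hf hef hfe => h.eq_of_idempotent_le he hf hef hfe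
    obtain ⟨x⟩ := ‹Nonempty S›
    have hb := hB.mul_self (ε x).2
    exact ⟨G, _, B, _, (h.of_injective (ε.leftFactorHom hb).toSemigroupLangHom
      (ε.leftFactorHom_injective hb)).toGroupLang, hB, ⟨ε⟩⟩
  · rintro ⟨G, _, B, _, hG, ⟨L, R, _, _, η, hη⟩, ⟨ε⟩⟩
    refine IsSolvableAlg.of_groupPart ((MulHom.fst G B).comp ε.toMulHom)
      (l := fun x => (η (ε x).2).1) (r := fun x => (η (ε x).2).2) (fun x y => ?_) (fun x y => ?_)
      (fun x y h₁ h₂ h₃ => ?_) hn hG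
    · rw [map_mul, Prod.snd_mul, hη]
    · rw [map_mul, Prod.snd_mul, hη]
    · exact ε.injective (Prod.ext h₁ (η.injective (Prod.ext h₂ h₃)))
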